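/- Let $\mathcal P$ be the set of probability distributions on $[0,1]$; for $P\in\mathcal P$ let $\bar P(x)=P((x,1])$, and let $d(P,Q)=\int_0^1|\bar P(x)-\bar Q(x)|\,dx$ be the type-1 Wasserstein distance. Let $\mathcal M$ be the set of pairs $(q,m)$ with $q:[0,1]\to[0,1]$, $m:[0,1]\to\mathbb R$, $q(v)v-m(v)\ge 0$ and $q(v)v-m(v)\ge q(\omega)v-m(\omega)$ for all $v,\omega\in[0,1]$ (individually rational, incentive compatible direct selling mechanisms). Fix a reference distribution $P_0\in\mathcal P$ with mean $\mu_0$, and a radius $0<r<\mu_0$. The robust optimization (RO) problem is $$\Pi^*_{RO}(r)=\sup_{(q,m)\in\mathcal M}\ \inf_{P\in\mathcal P:\ d(P,P_0)\le r}\mathbb E_P[m(\tilde v)].$$ The robust satisficing (RS) problem with target $\tau$ is to minimize $k$ over $(q,m)\in\mathcal M$ and $k>0$ subject to $\tau-\mathbb E_P[m(\tilde v)]\le k\,d(P,P_0)$ for all $P\in\mathcal P$. A mechanism is RO-optimal if it attains the supremum, and RS-optimal if together with some $k$ it attains the minimum. Write $\pi=\Pi^*_{RO}(r)$, and suppose that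 there are finitely many intervals $[u_j,w_j)$, $j=1,\dots,J$, with $0\le u_1<w_1<u_2<w_2<\dots<u_J<w_J\le 1$, such that $x\bar P_0(x)\ge\pi$ for all $x\in\bigcup_j[u_j,w_j)$ and $x\bar P_0(x)\le\pi$ for all other $x\in[0,1]$. Suppose that $$\tau=\Pi^*_{RO}(r)+\frac{r}{\sum_{j=1}^J\ln(w_j/u_j)} .$$ Then the RO and RS problems have the same optimal selling mechanism, in the following sense. (a) The mechanism $$q(v)=\frac{\sum_{j}\ln\big(\min\{\max\{v,u_j\},w_j\}/u_j\big)}{\sum_{j}\ln(w_j/u_j)},\qquad m(v)=\frac{\sum_{j}\big(\min\{\max\{v,u_j\},w_j\}-u_j\big)}{\sum_{j}\ln(w_j/u_j)}$$ belongs to $\mathcal M$ and is both RO-optimal and RS-optimal. (b) Every RS-optimal mechanism is RO-optimal. (c) If moreover the set $\{x\in[0,1]: x\bar P_0(x)=\pi\}$ has Lebesgue measure zero, then the RO-optimal mechanisms are exactly the RS-optimal mechanisms. -/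

import Mathlib

open MeasureTheory Set

namespace RobustMechanism

noncomputable section

/-- Valuations: the closed interval from 0 to 1. -/
abbrev Val : Type := unitInterval

/-- Distributions supported on the unit interval. -/
abbrev Dist : Type := ProbabilityMeasure Val

/-- A direct selling mechanism: allocation rule `q` with values in the unit interval and payment
rule `m`, individually rational and incentive compatible. -/
@[ext]
structure Mechanism where
  q : Val → ℝ
  m : Val → ℝ
  q_nonneg : ∀ v, 0 ≤ q v
  q_le_one : ∀ v, q v ≤ 1
  individually_rational : ∀ v : Val, 0 ≤ q v * (v : ℝ) - m v
  incentive_compatible : ∀ v z : Val, q z * (v : ℝ) - m z ≤ q v * (v : ℝ) - m v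

/-- Complementary cumulative distribution function, the probability of a valuation `> x`. -/
def ccdf (P : Dist) (x : ℝ) : ℝ := (P : Measure Val).real {v : Val | x < (v : ℝ)}

/-- Type-1 Wasserstein distance. -/
def wdist (P P₀ : Dist) : ℝ := ∫ x in (0 : ℝ)..1, |ccdf P x - ccdf P₀ x|

/-- The Wasserstein ambiguity set of radius `r`. -/
def ball (P₀ : Dist) (r : ℝ) : Set Dist := {P | wdist P P₀ ≤ r}

/-- Mean valuation. -/
def mean (P : Dist) : ℝ := ∫ v : Val, (v : ℝ) ∂(P : Measure Val)

/-- Expected payment. By incentive compatibility the payment rule is monotone, hence bounded and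
measurable, so that the integral is always a genuine one. -/
def revenue (M : Mechanism) (P : Dist) : ℝ := ∫ v : Val, M.m v ∂(P : Measure Val)

/-- Worst-case expected revenue over the ambiguity set. -/
def worstRevenue (P₀ : Dist) (r : ℝ) (M : Mechanism) : ℝ :=
  ⨅ P : ball P₀ r, revenue M P

/-- The optimal value of the robust optimization problem. -/
def roValue (P₀ : Dist) (r : ℝ) : ℝ := ⨆ M : Mechanism, worstRevenue P₀ r M

/-- The optimal mechanisms of the robust optimization problem. -/
def roOptimal (P₀ : Dist) (r : ℝ) : Set Mechanism :=
  {M | ∀ M' : Mechanism, worstRevenue P₀ r M' ≤ worstRevenue P₀ r M}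

/-- Feasibility of the pair `(M, k)` in the robust satisficing problem with target `τ`. -/
def RSFeasible (P₀ : Dist) (τ : ℝ) (M : Mechanism) (k : ℝ) : Prop :=
  0 < k ∧ ∀ P : Dist, τ - revenue M P ≤ k * wdist P P₀

/-- The optimal mechanisms of the robust satisficing problem: those that attain, with some
fragility `k`, the least fragility over all feasible pairs. -/
def rsOptimal (P₀ : Dist) (τ : ℝ) : Set Mechanism :=
  {M | ∃ k, RSFeasible P₀ τ M k ∧ ∀ M' k', RSFeasible P₀ τ M' k' → k ≤ k'}

/-- The finitely many disjoint intervals `[u j, w j)` on which the CCDF of the reference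
distribution is at least the iso-revenue curve `c / x` (written without division); off the
intervals it does not exceed that curve. -/
structure IsExceedance (P₀ : Dist) (c : ℝ) {J : ℕ} (u w : Fin J → ℝ) : Prop where
  nonneg : ∀ j, 0 ≤ u j
  lt : ∀ j, u j < w j
  le_one : ∀ j, w j ≤ 1
  sep : ∀ i j, i < j → w i < u j
  ge : ∀ j, ∀ x ∈ Ico (u j) (w j), c ≤ x * ccdf P₀ x
  exceed : ∀ x ∈ Icc (0 : ℝ) 1, c < x * ccdf P₀ x → ∃ j, x ∈ Ico (u j) (w j)

end

end RobustMechanism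

open RobustMechanism

namespace RobustMechanism

open Filter Topology ProbabilityTheory

/-! Write e(c) for `excess P₀ c`, the area of the CCDF of `P₀` above the curve c/x. Capping the CCDF
at c/x costs Wasserstein distance exactly e(c) and leaves no posted price earning more than c; an
incentive compatible mechanism is in effect a random posted price, so no mechanism does better
(`exists_wdist_eq_excess`). Since e is continuous, e(0) is the mean and e(1) = 0, some c > 0 has
e(c) = r, and the robust value is at most c.

Conversely, let S select the region where the CCDF is above c/x, let L be the integral of S(x)/x,
and post a random price with density S(x)/(xL). Its revenue is the integral of S against the CCDF,
divided by L. This changes by at most d/L over Wasserstein distance d, which gives the linear bound: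
revenue under P is at least c + (r - d(P,P₀))/L (`exists_mechanism_revenue_ge`). Hence the robust
value is c, and fragility 1/L is feasible for the target c + r/L. The capped distribution shows that
no smaller fragility is. So the RS-optimal mechanisms are exactly those that satisfy the linear
bound, and the bound implies RO-optimality.

If ties form a null set, e has derivative -L at c. Mixing a little of any P with a distribution
capped near level c then forces the linear bound on every RO-optimal mechanism
(`revenue_ge_of_hasDerivAt`). -/

/-! ### CCDFs, the Wasserstein distance and expectations of primitives -/

lemma ccdf_nonneg (P : Dist) (x : ℝ) : 0 ≤ ccdf P x := measureReal_nonneg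

lemma ccdf_le_one (P : Dist) (x : ℝ) : ccdf P x ≤ 1 := measureReal_le_one

lemma ccdf_antitone (P : Dist) : Antitone (ccdf P) := fun _ _ hxy =>
  measureReal_mono fun _ hv => lt_of_le_of_lt hxy hv

lemma ccdf_measurable (P : Dist) : Measurable (ccdf P) := (ccdf_antitone P).measurable

lemma ccdf_eq_zero (P : Dist) {x : ℝ} (hx : 1 ≤ x) : ccdf P x = 0 := by
  have : {v : Val | x < (v : ℝ)} = ∅ := by
    ext v
    simpa using v.2.2.trans hx
  simp [ccdf, this]

lemma ccdf_intervalIntegrable (P : Dist) (a b : ℝ) : IntervalIntegrable (ccdf P) volume a b :=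
  (ccdf_antitone P).intervalIntegrable

lemma measurableSet_lt_val (x : ℝ) : MeasurableSet {v : Val | x < (v : ℝ)} :=
  measurableSet_lt measurable_const measurable_subtype_coe

lemma wdist_nonneg (P Q : Dist) : 0 ≤ wdist P Q :=
  intervalIntegral.integral_nonneg zero_le_one fun _ _ => abs_nonneg _

lemma wdist_self (P : Dist) : wdist P P = 0 := by simp [wdist]

/-- Fubini for the tail: the expectation of a primitive is an integral against the CCDF. -/
lemma integral_primitive (P : Dist) {k : ℝ → ℝ} (hk : IntervalIntegrable k volume 0 1) :
    ∫ v : Val, (∫ x in (0 : ℝ)..v, k x) ∂(P : Measure Val) = ∫ x in (0 : ℝ)..1, k x * ccdf P x := by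
  have h01 : (0 : ℝ) ≤ 1 := zero_le_one
  have hk' : Integrable k (volume.restrict (Ioc 0 1)) :=
    (intervalIntegrable_iff_integrableOn_Ioc_of_le h01).1 hk
  have h1 : ∀ v : Val, (∫ x in (0 : ℝ)..v, k x) =
      ∫ x in Ioc (0 : ℝ) 1, {p : Val × ℝ | p.2 < (p.1 : ℝ)}.indicator (fun p => k p.2) (v, x) := by
    intro v
    -- The CCDF counts valuations strictly above x, so the null endpoint x = v is dropped before the
    -- two sets are compared.
    rw [intervalIntegral.integral_of_le v.2.1, integral_Ioc_eq_integral_Ioo]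
    have : (fun x : ℝ => {p : Val × ℝ | p.2 < (p.1 : ℝ)}.indicator (fun p => k p.2) (v, x)) =
        (Iio (v : ℝ)).indicator k := by
      ext x
      simp [indicator]
    rw [this, setIntegral_indicator measurableSet_Iio]
    congr 2
    ext x
    simp only [mem_Ioo, mem_inter_iff, mem_Ioc, mem_Iio]
    have := v.2.2
    constructor
    · rintro ⟨a, b⟩
      exact ⟨⟨a, by linarith⟩, b⟩
    · rintro ⟨⟨a, _⟩, b⟩
      exact ⟨a, b⟩
  simp_rw [h1]
  have hm : MeasurableSet {p : Val × ℝ | p.2 < (p.1 : ℝ)} :=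
    measurableSet_lt measurable_snd (measurable_subtype_coe.comp measurable_fst)
  rw [integral_integral_swap (f := fun (v : Val) (x : ℝ) =>
    {p : Val × ℝ | p.2 < (p.1 : ℝ)}.indicator (fun p => k p.2) (v, x))]
  · rw [intervalIntegral.integral_of_le h01]
    congr 1
    ext x
    have : (fun v : Val => {p : Val × ℝ | p.2 < (p.1 : ℝ)}.indicator (fun p => k p.2) (v, x)) =
        {v : Val | x < (v : ℝ)}.indicator (fun _ => k x) := by
      ext v
      simp [indicator]
    rw [this, integral_indicator_const _ (measurableSet_lt_val x), smul_eq_mul, mul_comm]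
    rfl
  · exact (hk'.comp_snd (P : Measure Val)).indicator hm

lemma mean_eq_integral_ccdf (P : Dist) : mean P = ∫ x in (0 : ℝ)..1, ccdf P x := by
  have := integral_primitive P (k := fun _ => 1) (by simp)
  simpa [mean] using this

/-! ### Consequences of incentive compatibility -/

namespace Mechanism

variable (M : Mechanism)

lemma m_sub_le (v z : Val) : M.m z - M.m v ≤ z * (M.q z - M.q v) := by
  linarith [M.incentive_compatible z v, mul_comm (z : ℝ) (M.q z - M.q v)]

/-- Adding the two incentive constraints between v and z gives (z - v)(q z - q v) ≥ 0. -/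
lemma q_monotone : Monotone M.q := by
  intro v z h
  rcases h.eq_or_lt with rfl | h
  · exact le_rfl
  · have h' : (v : ℝ) < z := h
    nlinarith [M.m_sub_le v z, M.m_sub_le z v]

lemma m_monotone : Monotone M.m := by
  intro v z h
  nlinarith [M.m_sub_le z v, M.q_monotone h, v.2.1]

lemma m_zero_nonpos : M.m 0 ≤ 0 := by
  simpa using M.individually_rational 0

lemma integrable_m (P : Dist) : Integrable M.m (P : Measure Val) := by
  refine Integrable.of_bound M.m_monotone.measurable.aestronglyMeasurable (max |M.m 0| |M.m 1|)
    (Filter.Eventually.of_forall fun v => ?_)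
  rw [Real.norm_eq_abs]
  exact abs_le_max_abs_abs (M.m_monotone v.2.1) (M.m_monotone v.2.2)

lemma m_zero_le_revenue (P : Dist) : M.m 0 ≤ revenue M P := by
  have := integral_mono (integrable_const (M.m 0)) (M.integrable_m P)
    (fun v => M.m_monotone (show (0 : Val) ≤ v from v.2.1))
  simpa [revenue] using this

lemma bddBelow_revenue (P₀ : Dist) (r : ℝ) :
    BddBelow (range fun P : ball P₀ r => revenue M P) :=
  ⟨M.m 0, by rintro _ ⟨P, rfl⟩; exact M.m_zero_le_revenue P⟩

lemma worstRevenue_le {P₀ P : Dist} {r : ℝ} (h : wdist P P₀ ≤ r) :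
    worstRevenue P₀ r M ≤ revenue M P :=
  ciInf_le (M.bddBelow_revenue P₀ r) (⟨P, h⟩ : ball P₀ r)

lemma le_worstRevenue {P₀ : Dist} {r c : ℝ} (hr : 0 ≤ r)
    (h : ∀ P, wdist P P₀ ≤ r → c ≤ revenue M P) : c ≤ worstRevenue P₀ r M := by
  have : Nonempty (ball P₀ r) := ⟨⟨P₀, by simpa [ball, wdist_self] using hr⟩⟩
  exact le_ciInf fun P => h P P.2

end Mechanism

/-! ### No mechanism beats the best posted price -/

/-- If no posted price earns more than `c`, then no mechanism does. -/
lemma revenue_le_of_mul_ccdf_le (M : Mechanism) (P : Dist) {c : ℝ}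
    (h : ∀ x, 0 ≤ x → x * ccdf P x ≤ c) : revenue M P ≤ c := by
  have hc : 0 ≤ c := by simpa using h 0 le_rfl
  have key : ∀ n : ℕ, revenue M P ≤ c + 1 / ((n : ℝ) + 1) := by
    intro n
    have hn : (0 : ℝ) < (n : ℝ) + 1 := by positivity
    -- A uniform grid replaces the Stieltjes integral of the price against dq, so q needs no
    -- regularity; the error is one mesh width.
    let pt : ℕ → Val := fun j => projIcc 0 1 zero_le_one ((j : ℝ) / (n + 1))
    have pt_mono : ∀ j, pt j ≤ pt (j + 1) := fun j =>
      monotone_projIcc _ (by push_cast; gcongr; linarith)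
    have pt_step : ∀ j, ((pt (j + 1) : Val) : ℝ) ≤ pt j + 1 / ((n : ℝ) + 1) := by
      intro j
      have h0 : (0 : ℝ) ≤ 1 / ((n : ℝ) + 1) := by positivity
      simp only [pt, coe_projIcc]
      push_cast
      rw [add_div]
      refine max_le (add_nonneg (le_max_left _ _) h0) ?_
      rcases le_total ((j : ℝ) / (n + 1)) 1 with hj | hj
      · rw [min_eq_right hj]
        exact (min_le_right _ _).trans (by gcongr; exact le_max_right _ _)
      · rw [min_eq_left hj]
        exact (min_le_left _ _).trans (by linarith [le_max_right (0 : ℝ) 1])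
    -- By `m_sub_le`, the payment rises by at most `a j` across the j-th cell. Below, `a j` is
    -- charged to every v above the left end of the cell, which can only overestimate the payment.
    let a : ℕ → ℝ := fun j => (pt (j + 1) : ℝ) * (M.q (pt (j + 1)) - M.q (pt j))
    have bound : ∀ (v : Val) (k : ℕ), M.m (min v (pt k)) ≤
        ∑ j ∈ Finset.range k, {v : Val | (pt j : ℝ) < v}.indicator (fun _ => a j) v := by
      intro v k
      induction k with
      | zero =>
        have h0 : pt 0 = 0 := by
          apply Subtype.ext
          simp [pt]
        have : min v (pt 0) = 0 := by rw [h0]; exact min_eq_right v.2.1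
        rw [this]
        simpa using M.m_zero_nonpos
      | succ k ih =>
        rw [Finset.sum_range_succ]
        by_cases hv : pt k < v
        · have hv' : v ∈ {v : Val | (pt k : ℝ) < v} := hv
          rw [indicator_of_mem hv']
          rw [min_eq_right hv.le] at ih
          have h1 := M.m_monotone (min_le_right v (pt (k + 1)))
          have h2 := M.m_sub_le (pt k) (pt (k + 1))
          simp only [a]
          linarith
        · have hv' : v ∉ {v : Val | (pt k : ℝ) < v} := hv
          rw [indicator_of_notMem hv', add_zero]
          have hle : v ≤ pt k := not_lt.1 hv
          rw [min_eq_left (hle.trans (pt_mono k))]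
          rwa [min_eq_left hle] at ih
    have hlast : pt (n + 1) = 1 := by
      apply Subtype.ext
      simp [pt, div_self hn.ne']
    have hint : ∀ j, Integrable ({v : Val | (pt j : ℝ) < v}.indicator (fun _ => a j))
        (P : Measure Val) := fun j =>
      (integrable_const _).indicator (measurableSet_lt_val _)
    have h1 : revenue M P ≤ ∑ j ∈ Finset.range (n + 1), ccdf P (pt j) * a j := by
      have := integral_mono (M.integrable_m P)
        (integrable_finsetSum (Finset.range (n + 1)) fun j _ => hint j) (fun v => by
          have := bound v (n + 1)
          rwa [hlast, min_eq_left (show v ≤ 1 from v.2.2)] at this)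
      rw [integral_finsetSum _ fun j _ => hint j] at this
      refine this.trans_eq (Finset.sum_congr rfl fun j _ => ?_)
      rw [integral_indicator_const _ (measurableSet_lt_val _), smul_eq_mul]
      rfl
    have h2 : ∀ j, ccdf P (pt j) * a j ≤
        (c + 1 / ((n : ℝ) + 1)) * (M.q (pt (j + 1)) - M.q (pt j)) := by
      intro j
      have hq : 0 ≤ M.q (pt (j + 1)) - M.q (pt j) := sub_nonneg.2 (M.q_monotone (pt_mono j))
      -- The price is the right endpoint but the demand is taken at the left one; the mismatch costs
      -- at most the mesh width because the CCDF is at most 1.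
      have : ccdf P (pt j) * (pt (j + 1) : ℝ) ≤ c + 1 / ((n : ℝ) + 1) := by
        have e1 := h (pt j) (pt j).2.1
        have e2 := mul_le_mul_of_nonneg_left (pt_step j) (ccdf_nonneg P (pt j))
        have e3 : ccdf P (pt j) * (1 / ((n : ℝ) + 1)) ≤ 1 * (1 / ((n : ℝ) + 1)) := by
          gcongr
          exact ccdf_le_one _ _
        linarith
      simpa [a, mul_assoc] using mul_le_mul_of_nonneg_right this hq
    have h3 := h1.trans (Finset.sum_le_sum fun j _ => h2 j)
    rw [← Finset.mul_sum, Finset.sum_range_sub fun j => M.q (pt j)] at h3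
    refine h3.trans ?_
    have hq : M.q (pt (n + 1)) - M.q (pt 0) ≤ 1 := by
      linarith [M.q_le_one (pt (n + 1)), M.q_nonneg (pt 0)]
    have : 0 ≤ c + 1 / ((n : ℝ) + 1) := by positivity
    nlinarith
  have hlim : Filter.Tendsto (fun n : ℕ => c + 1 / ((n : ℝ) + 1)) Filter.atTop (nhds (c + 0)) :=
    tendsto_const_nhds.add tendsto_one_div_add_atTop_nhds_zero_nat
  rw [add_zero] at hlim
  exact ge_of_tendsto' hlim key

/-! ### Capping by the iso-revenue curve -/

lemma ccdf_eq_one_sub_cdf (P : Dist) (x : ℝ) :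
    ccdf P x = 1 - cdf ((P : Measure Val).map Subtype.val) x := by
  have : IsProbabilityMeasure ((P : Measure Val).map Subtype.val) :=
    Measure.isProbabilityMeasure_map measurable_subtype_coe.aemeasurable
  rw [ccdf, cdf_eq_real, map_measureReal_apply measurable_subtype_coe measurableSet_Iic,
    ← probReal_compl_eq_one_sub (measurable_subtype_coe measurableSet_Iic)]
  congr 1
  ext v
  simp

/-- Capping the CCDF by the iso-revenue curve `c / x`. -/
lemma exists_ccdf_eq_min (P₀ : Dist) {c : ℝ} (hc : 0 < c) :
    ∃ P : Dist, ∀ x, 0 < x → ccdf P x = min (ccdf P₀ x) (c / x) := by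
  have cont : Continuous fun x : ℝ => 1 - c / max x c :=
    continuous_const.sub (continuous_const.div (continuous_id.max continuous_const)
      fun x => (lt_max_of_lt_right hc).ne')
  -- The CDF of the capped law. Replacing x by `max x c` keeps c/x at most 1 and continuous; nothing
  -- is lost, since c/x ≥ 1 is not binding when x ≤ c.
  let f : StieltjesFunction ℝ :=
    { toFun := fun x => max (cdf ((P₀ : Measure Val).map Subtype.val) x) (1 - c / max x c)
      mono' := (monotone_cdf _).max fun x y h => by
        have : 0 < max x c := lt_max_of_lt_right hc
        show 1 - c / max x c ≤ 1 - c / max y c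
        gcongr
      right_continuous' := fun x =>
        ((cdf ((P₀ : Measure Val).map Subtype.val)).right_continuous x).max
          cont.continuousWithinAt }
  have hf : ∀ x, f x = 1 - min (ccdf P₀ x) (c / max x c) := by
    intro x
    change max _ _ = _
    rw [ccdf_eq_one_sub_cdf, ← max_sub_sub_left, sub_sub_cancel]
  have hone : ∀ x, 1 ≤ x → f x = 1 := by
    intro x hx
    have : 0 ≤ c / max x c := div_nonneg hc.le (hc.le.trans (le_max_right _ _))
    rw [hf, ccdf_eq_zero _ hx, min_eq_left this, sub_zero]
  have hzero : ∀ x, x < 0 → f x = 0 := by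
    intro x hx
    have : ccdf P₀ x = 1 := by
      have : {v : Val | x < (v : ℝ)} = univ := eq_univ_of_forall fun v => hx.trans_le v.2.1
      simp [ccdf, this]
    rw [hf, this, max_eq_right (hx.trans hc).le, div_self hc.ne', min_self, sub_self]
  have htop : Tendsto f atTop (𝓝 1) :=
    tendsto_const_nhds.congr' ((eventually_ge_atTop 1).mono fun x hx => (hone x hx).symm)
  have hbot : Tendsto f atBot (𝓝 0) :=
    tendsto_const_nhds.congr' ((eventually_lt_atBot 0).mono fun x hx => (hzero x hx).symm)
  have hprob : IsProbabilityMeasure f.measure := f.isProbabilityMeasure hbot htop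
  have hproj : Measurable (projIcc (0 : ℝ) 1 zero_le_one) := continuous_projIcc.measurable
  obtain ⟨P, hP⟩ : ∃ P : Dist, (P : Measure Val) = f.measure.map (projIcc (0 : ℝ) 1 zero_le_one) :=
    ⟨⟨_, Measure.isProbabilityMeasure_map hproj.aemeasurable⟩, rfl⟩
  refine ⟨P, fun x hx => ?_⟩
  rcases le_or_gt 1 x with h1 | h1
  · rw [ccdf_eq_zero _ h1, ccdf_eq_zero _ h1, min_eq_left (by positivity)]
  · have hpre : projIcc (0 : ℝ) 1 zero_le_one ⁻¹' {v : Val | x < (v : ℝ)} = Ioi x := by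
      ext t
      simp [coe_projIcc, hx.not_gt, h1]
    rw [ccdf, hP, map_measureReal_apply hproj (measurableSet_lt_val x), hpre, measureReal_def,
      f.measure_Ioi htop, hf, sub_sub_cancel,
      ENNReal.toReal_ofReal (le_min (ccdf_nonneg _ _) (by positivity))]
    rcases le_total c x with h | h
    · rw [max_eq_left h]
    · rw [max_eq_right h, div_self hc.ne', min_eq_left (ccdf_le_one _ _),
        min_eq_left ((ccdf_le_one _ _).trans ((one_le_div hx).2 h))]

/-! ### The excess area as a function of the revenue level -/

/-- The amount by which the CCDF exceeds the iso-revenue curve `c / x`. -/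
noncomputable def excess (P₀ : Dist) (c : ℝ) : ℝ :=
  ∫ x in (0 : ℝ)..1, max (ccdf P₀ x - c / x) 0

/-- The capped law serves as the adversary in both problems: capping only lowers the CCDF, so the
distance is the area cut off, and x times the capped CCDF never exceeds c. -/
lemma exists_wdist_eq_excess (P₀ : Dist) {c : ℝ} (hc : 0 < c) :
    ∃ P : Dist, wdist P P₀ = excess P₀ c ∧ ∀ M, revenue M P ≤ c := by
  obtain ⟨P, hP⟩ := exists_ccdf_eq_min P₀ hc
  refine ⟨P, ?_, fun M => revenue_le_of_mul_ccdf_le M P fun x hx => ?_⟩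
  · refine intervalIntegral.integral_congr_ae (Eventually.of_forall fun x hx => ?_)
    rw [uIoc_of_le zero_le_one] at hx
    rw [hP x hx.1]
    rcases le_total (ccdf P₀ x) (c / x) with h | h
    · rw [min_eq_left h, sub_self, abs_zero, max_eq_right (by linarith)]
    · rw [min_eq_right h, abs_of_nonpos (by linarith), max_eq_left (by linarith)]
      ring
  · rcases hx.eq_or_lt with rfl | hx
    · simpa using hc.le
    · rw [hP x hx]
      calc x * min (ccdf P₀ x) (c / x) ≤ x * (c / x) := by gcongr; exact min_le_right _ _
        _ = c := by field_simp

lemma excess_integrand_measurable (P₀ : Dist) (c : ℝ) :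
    Measurable fun x => max (ccdf P₀ x - c / x) 0 :=
  ((ccdf_measurable P₀).sub (measurable_const.div measurable_id)).max measurable_const

lemma excess_integrand_bound (P₀ : Dist) {c x : ℝ} (hc : 0 ≤ c) (hx : 0 ≤ x) :
    ‖max (ccdf P₀ x - c / x) 0‖ ≤ 1 := by
  rw [Real.norm_of_nonneg (le_max_right _ _)]
  exact max_le (by linarith [ccdf_le_one P₀ x, div_nonneg hc hx]) zero_le_one

lemma excess_zero (P₀ : Dist) : excess P₀ 0 = mean P₀ := by
  simp [excess, mean_eq_integral_ccdf, ccdf_nonneg]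

lemma excess_one (P₀ : Dist) : excess P₀ 1 = 0 := by
  refine intervalIntegral.integral_zero_ae (Eventually.of_forall fun x hx => ?_)
  rw [uIoc_of_le zero_le_one] at hx
  exact max_eq_right (by linarith [ccdf_le_one P₀ x, (one_le_div hx.1).2 hx.2])

lemma continuousOn_excess (P₀ : Dist) : ContinuousOn (excess P₀) (Ici 0) := by
  have : excess P₀ = fun c => ∫ x in Ioc (0 : ℝ) 1, max (ccdf P₀ x - c / x) 0 := by
    ext c
    exact intervalIntegral.integral_of_le zero_le_one
  rw [this]
  refine continuousOn_of_dominated (bound := fun _ => 1)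
    (fun c _ => (excess_integrand_measurable P₀ c).aestronglyMeasurable)
    (fun c hc => (ae_restrict_iff' measurableSet_Ioc).2
      (Eventually.of_forall fun x hx => excess_integrand_bound P₀ hc hx.1.le))
    (integrable_const _) (Eventually.of_forall fun x => ?_)
  exact ((continuous_const.sub (continuous_id.div_const x)).max continuous_const).continuousOn

lemma exists_excess_eq (P₀ : Dist) {r : ℝ} (hr : 0 < r) (hrμ : r < mean P₀) :
    ∃ c, 0 < c ∧ excess P₀ c = r := by
  have h := intermediate_value_Icc' (zero_le_one' ℝ)
    ((continuousOn_excess P₀).mono Icc_subset_Ici_self)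
  rw [excess_one, excess_zero] at h
  obtain ⟨c, hc, rfl⟩ := h ⟨hr.le, hrμ.le⟩
  refine ⟨c, hc.1.lt_of_ne ?_, rfl⟩
  -- Level 0 would have excess equal to the mean, which is larger than r.
  rintro rfl
  exact hrμ.ne (excess_zero P₀)

/-- If the curve `c / x` meets the CCDF only on a null set, the excess is differentiable. -/
lemma hasDerivAt_excess (P₀ : Dist) {c : ℝ} (hc : 0 < c) {S : ℝ → ℝ} (hS : Measurable S)
    (hgt : ∀ x ∈ Ioc (0 : ℝ) 1, c < x * ccdf P₀ x → S x = 1)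
    (hlt : ∀ x ∈ Ioc (0 : ℝ) 1, x * ccdf P₀ x < c → S x = 0)
    (hnull : volume {x : ℝ | x ∈ Icc (0 : ℝ) 1 ∧ x * ccdf P₀ x = c} = 0) :
    HasDerivAt (excess P₀) (-∫ x in (0 : ℝ)..1, S x / x) c := by
  have hc2 : c / 2 < c := by linarith
  rw [← intervalIntegral.integral_neg]
  -- On levels a > c/2 the integrand is (2/c)-Lipschitz in a: for x < c/2 it vanishes because a/x >
  -- 1, and otherwise its slope is at most 1/x ≤ 2/c.
  refine (intervalIntegral.hasDerivAt_integral_of_dominated_loc_of_lip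
    (F := fun c x => max (ccdf P₀ x - c / x) 0) (bound := fun _ => 2 / c)
    (Ioi_mem_nhds hc2)
    (Eventually.of_forall fun c => (excess_integrand_measurable P₀ c).aestronglyMeasurable) ?_
    (hS.div measurable_id).neg.aestronglyMeasurable
    (Eventually.of_forall fun x hx => ?_) (by simp) ?_).2
  · rw [intervalIntegrable_iff_integrableOn_Ioc_of_le zero_le_one]
    exact Integrable.of_bound (excess_integrand_measurable P₀ c).aestronglyMeasurable 1
      ((ae_restrict_iff' measurableSet_Ioc).2
        (Eventually.of_forall fun x hx => excess_integrand_bound P₀ hc.le hx.1.le))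
  · rw [uIoc_of_le zero_le_one] at hx
    rw [lipschitzOnWith_iff_dist_le_mul]
    intro a ha b hb
    simp only [Real.dist_eq, Real.coe_nnabs]
    rw [abs_of_pos (div_pos two_pos hc)]
    rcases lt_or_ge x (c / 2) with hxc | hxc
    · have hz : ∀ a ∈ Ioi (c / 2), max (ccdf P₀ x - a / x) 0 = 0 := fun a ha =>
        max_eq_right (by linarith [ccdf_le_one P₀ x, (one_le_div hx.1).2 (hxc.trans ha).le])
      rw [hz a ha, hz b hb, sub_self, abs_zero]
      positivity
    · refine (abs_max_sub_max_le_abs _ _ _).trans ?_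
      have : ccdf P₀ x - a / x - (ccdf P₀ x - b / x) = x⁻¹ * (b - a) := by
        field_simp
        ring
      rw [this, abs_mul, abs_sub_comm b a, abs_of_pos (inv_pos.2 hx.1)]
      gcongr
      rw [show 2 / c = (c / 2)⁻¹ by rw [inv_div]]
      gcongr
  · have hae : ∀ᵐ x : ℝ, x ∉ {x : ℝ | x ∈ Icc (0 : ℝ) 1 ∧ x * ccdf P₀ x = c} :=
      measure_eq_zero_iff_ae_notMem.1 hnull
    filter_upwards [hae] with x hx hx01
    rw [uIoc_of_le zero_le_one] at hx01
    have hlin : HasDerivAt (fun a => ccdf P₀ x - a / x) (-(1 / x)) c := by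
      simpa using ((hasDerivAt_id c).div_const x).const_sub (ccdf P₀ x)
    have hcont : ContinuousAt (fun a => ccdf P₀ x - a / x) c := hlin.continuousAt
    change HasDerivAt _ (-(S x / x)) c
    -- Off the tie set, one branch of the maximum is active for all levels near c, so the integrand
    -- is locally zero or affine there.
    rcases lt_trichotomy (x * ccdf P₀ x) c with h | h | h
    · rw [hlt x hx01 h, zero_div, neg_zero]
      have hneg : ccdf P₀ x - c / x < 0 := by
        rw [sub_neg, lt_div_iff₀ hx01.1]
        linarith
      refine (hasDerivAt_const c (0 : ℝ)).congr_of_eventuallyEq ?_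
      filter_upwards [hcont.eventually_lt_const hneg] with a ha
      exact max_eq_right ha.le
    · exact absurd ⟨⟨hx01.1.le, hx01.2⟩, h⟩ hx
    · rw [hgt x hx01 h]
      have hpos : 0 < ccdf P₀ x - c / x := by
        rw [sub_pos, div_lt_iff₀ hx01.1]
        linarith
      refine hlin.congr_of_eventuallyEq ?_
      filter_upwards [hcont.eventually_const_lt hpos] with a ha
      exact max_eq_left ha.le

/-! ### Mixtures of distributions -/

/-- Mixtures: revenue is affine and the Wasserstein distance is convex. -/
lemma exists_mixture (P Q P₀ : Dist) {t : ℝ} (ht0 : 0 ≤ t) (ht1 : t ≤ 1) :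
    ∃ R : Dist, (∀ M, revenue M R = (1 - t) * revenue M P + t * revenue M Q) ∧
      wdist R P₀ ≤ (1 - t) * wdist P P₀ + t * wdist Q P₀ := by
  have ht : 0 ≤ 1 - t := sub_nonneg.2 ht1
  let μ : Measure Val := ENNReal.ofReal (1 - t) • (P : Measure Val) +
    ENNReal.ofReal t • (Q : Measure Val)
  have hμ : IsProbabilityMeasure μ := ⟨by
    simp [μ, ← ENNReal.ofReal_add ht ht0]⟩
  obtain ⟨R, hR⟩ : ∃ R : Dist, (R : Measure Val) = μ := ⟨⟨μ, hμ⟩, rfl⟩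
  have hfin : ∀ (a : ℝ) (D : Dist) (s : Set Val),
      (ENNReal.ofReal a • (D : Measure Val)) s ≠ ⊤ := fun a D s =>
    ENNReal.mul_ne_top ENNReal.ofReal_ne_top (measure_ne_top _ s)
  have hccdf : ∀ x, ccdf R x = (1 - t) * ccdf P x + t * ccdf Q x := by
    intro x
    rw [ccdf, hR, measureReal_add_apply (hfin _ _ _) (hfin _ _ _), measureReal_ennreal_smul_apply,
      measureReal_ennreal_smul_apply, ENNReal.toReal_ofReal ht, ENNReal.toReal_ofReal ht0]
    rfl
  refine ⟨R, fun M => ?_, ?_⟩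
  · rw [revenue, hR, integral_add_measure ((M.integrable_m P).smul_measure ENNReal.ofReal_ne_top)
      ((M.integrable_m Q).smul_measure ENNReal.ofReal_ne_top), integral_smul_measure,
      integral_smul_measure, ENNReal.toReal_ofReal ht, ENNReal.toReal_ofReal ht0]
    rfl
  · have hi : ∀ R : Dist, IntervalIntegrable (fun x => |ccdf R x - ccdf P₀ x|) volume 0 1 :=
      fun R => ((ccdf_intervalIntegrable R 0 1).sub (ccdf_intervalIntegrable P₀ 0 1)).abs
    unfold wdist
    rw [← intervalIntegral.integral_const_mul, ← intervalIntegral.integral_const_mul,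
      ← intervalIntegral.integral_add ((hi P).const_mul _) ((hi Q).const_mul _)]
    refine intervalIntegral.integral_mono_on zero_le_one (hi _)
      (((hi P).const_mul _).add ((hi Q).const_mul _)) fun x _ => ?_
    rw [hccdf]
    calc |(1 - t) * ccdf P x + t * ccdf Q x - ccdf P₀ x|
        = |(1 - t) * (ccdf P x - ccdf P₀ x) + t * (ccdf Q x - ccdf P₀ x)| := by ring_nf
      _ ≤ _ := by
        refine (abs_add_le _ _).trans_eq ?_
        rw [abs_mul, abs_mul, abs_of_nonneg ht, abs_of_nonneg ht0]

/-! ### Random posted prices and their guarantee -/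

/-- The mechanism that posts a random price with density `h`. -/
noncomputable def Mechanism.ofDensity (h : ℝ → ℝ) (hi : IntervalIntegrable h volume 0 1)
    (h0 : ∀ x, 0 ≤ x → 0 ≤ h x) (h1 : ∫ x in (0 : ℝ)..1, h x = 1) : Mechanism :=
  have hsub : ∀ a b : Val, IntervalIntegrable h volume a b := fun a b =>
    hi.mono_set (by
      rw [uIcc_of_le (zero_le_one' ℝ)]
      exact uIcc_subset_Icc a.2 b.2)
  have hsub' : ∀ a b : Val, IntervalIntegrable (fun x => x * h x) volume a b := fun a b =>
    (hsub a b).continuousOn_mul continuousOn_id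
  have key : ∀ v z : Val, 0 ≤ ∫ x in (z : ℝ)..v, (h x * v - x * h x) := by
    intro v z
    rcases le_total z v with hzv | hzv
    · refine intervalIntegral.integral_nonneg hzv fun x hx => ?_
      nlinarith [h0 x (z.2.1.trans hx.1), hx.2]
    · rw [intervalIntegral.integral_symm, ← intervalIntegral.integral_neg]
      refine intervalIntegral.integral_nonneg hzv fun x hx => ?_
      nlinarith [h0 x (v.2.1.trans hx.1), hx.1]
  have surplus : ∀ v z : Val, (∫ x in (0 : ℝ)..v, h x) * v - (∫ x in (0 : ℝ)..v, x * h x) -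
      ((∫ x in (0 : ℝ)..z, h x) * v - ∫ x in (0 : ℝ)..z, x * h x) =
        ∫ x in (z : ℝ)..v, (h x * v - x * h x) := by
    intro v z
    rw [intervalIntegral.integral_sub ((hsub z v).mul_const _) (hsub' z v),
      intervalIntegral.integral_mul_const,
      ← intervalIntegral.integral_interval_sub_left (hsub 0 v) (hsub 0 z),
      ← intervalIntegral.integral_interval_sub_left (hsub' 0 v) (hsub' 0 z)]
    push_cast
    ring
  { q := fun v => ∫ x in (0 : ℝ)..v, h x
    m := fun v => ∫ x in (0 : ℝ)..v, x * h x
    q_nonneg := fun v => intervalIntegral.integral_nonneg v.2.1 fun x hx => h0 x hx.1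
    q_le_one := fun v => by
      have h2 := intervalIntegral.integral_add_adjacent_intervals (hsub 0 v) (hsub v 1)
      have h3 : 0 ≤ ∫ x in (v : ℝ)..1, h x :=
        intervalIntegral.integral_nonneg v.2.2 fun x hx => h0 x (v.2.1.trans hx.1)
      simp only [Icc.coe_zero, Icc.coe_one] at h2
      linarith
    individually_rational := fun v => by
      have := surplus v 0
      simp only [Icc.coe_zero, intervalIntegral.integral_same, zero_mul, sub_zero] at this
      rw [this]
      simpa using key v 0
    incentive_compatible := fun v z => by linarith [surplus v z, key v z] }

/-- Pointwise, a weight in [0,1] loses at most the absolute difference of the two CCDFs. -/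
lemma wdist_lower_bound (P P₀ : Dist) {S : ℝ → ℝ} (hS : Measurable S) (hS0 : ∀ x, 0 ≤ S x)
    (hS1 : ∀ x, S x ≤ 1) :
    (∫ x in (0 : ℝ)..1, S x * ccdf P₀ x) - wdist P P₀ ≤ ∫ x in (0 : ℝ)..1, S x * ccdf P x := by
  have hi : ∀ R : Dist, IntervalIntegrable (fun x => S x * ccdf R x) volume 0 1 := fun R =>
    (ccdf_intervalIntegrable R 0 1).mono_fun (hS.mul (ccdf_measurable R)).aestronglyMeasurable
      (Eventually.of_forall fun x => by
        simp only [norm_mul, Real.norm_eq_abs, abs_of_nonneg (hS0 x)]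
        exact mul_le_of_le_one_left (abs_nonneg _) (hS1 x))
  have ha : IntervalIntegrable (fun x => |ccdf P x - ccdf P₀ x|) volume 0 1 :=
    ((ccdf_intervalIntegrable P 0 1).sub (ccdf_intervalIntegrable P₀ 0 1)).abs
  rw [wdist, ← intervalIntegral.integral_sub (hi P₀) ha]
  refine intervalIntegral.integral_mono_on zero_le_one ((hi P₀).sub ha) (hi P) fun x _ => ?_
  nlinarith [neg_abs_le (ccdf P x - ccdf P₀ x), hS0 x, hS1 x, abs_nonneg (ccdf P x - ccdf P₀ x)]

/-- If `S` selects the points where the CCDF exceeds `c / x`, the random posted price with density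
proportional to `S x / x` loses revenue at most linearly in the Wasserstein distance. -/
lemma exists_mechanism_revenue_ge (P₀ : Dist) {c : ℝ} (hc : 0 < c) {S : ℝ → ℝ}
    (hS : Measurable S) (hS0 : ∀ x, 0 ≤ S x) (hS1 : ∀ x, S x ≤ 1)
    (hSe : ∀ x ∈ Ioc (0 : ℝ) 1, max (ccdf P₀ x - c / x) 0 = S x * (ccdf P₀ x - c / x))
    (hpos : 0 < excess P₀ c) :
    0 < ∫ x in (0 : ℝ)..1, S x / x ∧
    ∃ M : Mechanism,
      (∀ v : Val, M.q v = (∫ x in (0 : ℝ)..v, S x / x) / ∫ x in (0 : ℝ)..1, S x / x) ∧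
      (∀ v : Val, M.m v = (∫ x in (0 : ℝ)..v, S x) / ∫ x in (0 : ℝ)..1, S x / x) ∧
      ∀ P, c + (excess P₀ c - wdist P P₀) / (∫ x in (0 : ℝ)..1, S x / x) ≤ revenue M P := by
  have h01 : (0 : ℝ) ≤ 1 := zero_le_one
  have hSi : IntervalIntegrable (fun x => S x / x) volume 0 1 := by
    rw [intervalIntegrable_iff_integrableOn_Ioc_of_le h01]
    refine Integrable.of_bound (hS.div measurable_id).aestronglyMeasurable (1 / c)
      ((ae_restrict_iff' measurableSet_Ioc).2 (Eventually.of_forall fun x hx => ?_))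
    rw [Real.norm_of_nonneg (div_nonneg (hS0 x) hx.1.le)]
    -- There is no singularity at 0: for x < c the curve c/x exceeds 1, hence the CCDF, and `hSe`
    -- forces S to vanish.
    rcases lt_or_ge x c with h | h
    · have hneg : ccdf P₀ x - c / x < 0 := by
        linarith [ccdf_le_one P₀ x, (one_lt_div hx.1).2 h]
      have h2 := hSe x hx
      rw [max_eq_right hneg.le] at h2
      rcases mul_eq_zero.1 h2.symm with h3 | h3
      · rw [h3, zero_div]
        positivity
      · exact absurd h3 hneg.ne
    · exact div_le_div₀ zero_le_one (hS1 x) hc h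
  have hSc : IntervalIntegrable (fun x => S x * ccdf P₀ x) volume 0 1 :=
    (ccdf_intervalIntegrable P₀ 0 1).mono_fun (hS.mul (ccdf_measurable P₀)).aestronglyMeasurable
      (Eventually.of_forall fun x => by
        simp only [norm_mul, Real.norm_eq_abs, abs_of_nonneg (hS0 x)]
        exact mul_le_of_le_one_left (abs_nonneg _) (hS1 x))
  set L := ∫ x in (0 : ℝ)..1, S x / x with hL
  have hexc : excess P₀ c = (∫ x in (0 : ℝ)..1, S x * ccdf P₀ x) - c * L := by
    rw [hL, ← intervalIntegral.integral_const_mul,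
      ← intervalIntegral.integral_sub hSc (hSi.const_mul c)]
    refine intervalIntegral.integral_congr_ae (Eventually.of_forall fun x hx => ?_)
    rw [uIoc_of_le h01] at hx
    rw [hSe x hx]
    ring
  have hle : (∫ x in (0 : ℝ)..1, S x * ccdf P₀ x) ≤ L := by
    rw [intervalIntegral.integral_of_le h01, hL, intervalIntegral.integral_of_le h01]
    refine setIntegral_mono_on ((intervalIntegrable_iff_integrableOn_Ioc_of_le h01).1 hSc)
      ((intervalIntegrable_iff_integrableOn_Ioc_of_le h01).1 hSi) measurableSet_Ioc fun x hx => ?_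
    rw [div_eq_mul_inv]
    exact mul_le_mul_of_nonneg_left ((ccdf_le_one P₀ x).trans ((one_le_inv₀ hx.1).2 hx.2)) (hS0 x)
  have hL0 : 0 ≤ L := intervalIntegral.integral_nonneg h01 fun x hx => div_nonneg (hS0 x) hx.1
  -- By `hexc` and `hle` the excess is at most (1 - c)L, so L = 0 would contradict `hpos`.
  have hLpos : 0 < L := by nlinarith
  have hm : ∀ v : ℝ, 0 ≤ v → ∫ x in (0 : ℝ)..v, x * (S x / x / L) = (∫ x in (0 : ℝ)..v, S x) / L := by
    intro v hv
    rw [← intervalIntegral.integral_div]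
    refine intervalIntegral.integral_congr_ae (Eventually.of_forall fun x hx => ?_)
    rw [uIoc_of_le hv] at hx
    have := hx.1.ne'
    field_simp
  let M := Mechanism.ofDensity (fun x => S x / x / L) (hSi.div_const L)
    (fun x hx => div_nonneg (div_nonneg (hS0 x) hx) hL0)
    (by rw [intervalIntegral.integral_div, ← hL, div_self hLpos.ne'])
  refine ⟨hLpos, M, fun v => intervalIntegral.integral_div _ _, fun v => hm v v.2.1, fun P => ?_⟩
  have hrev : revenue M P = (∫ x in (0 : ℝ)..1, S x * ccdf P x) / L := by
    have := integral_primitive P (k := fun x => x * (S x / x / L))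
      ((hSi.div_const L).continuousOn_mul continuousOn_id)
    refine this.trans ?_
    rw [← intervalIntegral.integral_div]
    refine intervalIntegral.integral_congr_ae (Eventually.of_forall fun x hx => ?_)
    rw [uIoc_of_le h01] at hx
    have := hx.1.ne'
    field_simp
  rw [hrev, le_div_iff₀ hLpos, add_mul, div_mul_cancel₀ _ hLpos.ne', hexc]
  linarith [wdist_lower_bound P P₀ hS hS0 hS1]

/-! ### The value of the robust optimization problem -/

lemma Mechanism.worstRevenue_le_of_excess_eq (M : Mechanism) (P₀ : Dist) {r c : ℝ} (hc : 0 < c)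
    (hcr : excess P₀ c = r) : worstRevenue P₀ r M ≤ c := by
  obtain ⟨P, hP, hrev⟩ := exists_wdist_eq_excess P₀ hc
  exact (M.worstRevenue_le (hP.trans hcr).le).trans (hrev M)

/-- The selector here is the strict exceedance set, so the value is found without any interval
structure. -/
lemma roValue_eq (P₀ : Dist) {r c : ℝ} (hr : 0 < r) (hc : 0 < c) (hcr : excess P₀ c = r) :
    roValue P₀ r = c := by
  have hmeas : MeasurableSet {x : ℝ | c < x * ccdf P₀ x} :=
    measurableSet_lt measurable_const (measurable_id.mul (ccdf_measurable P₀))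
  obtain ⟨hL, M, -, -, hM⟩ := exists_mechanism_revenue_ge P₀ hc
    (S := {x : ℝ | c < x * ccdf P₀ x}.indicator 1) (measurable_one.indicator hmeas)
    (fun x => indicator_nonneg (fun _ _ => zero_le_one) x)
    (fun x => indicator_le_self' (fun _ _ => zero_le_one) x) (fun x hx => by
      by_cases h : c < x * ccdf P₀ x
      · rw [indicator_of_mem (show x ∈ {x : ℝ | c < x * ccdf P₀ x} from h), Pi.one_apply, one_mul]
        refine max_eq_left (sub_nonneg.2 ((div_le_iff₀ hx.1).2 ?_))
        linarith
      · rw [indicator_of_notMem (show x ∉ {x : ℝ | c < x * ccdf P₀ x} from h), zero_mul]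
        refine max_eq_right (sub_nonpos.2 ((le_div_iff₀ hx.1).2 ?_))
        linarith) (hcr ▸ hr)
  have : Nonempty Mechanism := ⟨M⟩
  refine le_antisymm (ciSup_le fun M => M.worstRevenue_le_of_excess_eq P₀ hc hcr) ?_
  -- A real supremum is meaningful only if bounded above; the capped law supplies the bound c.
  refine le_ciSup_of_le ⟨c, ?_⟩ M (M.le_worstRevenue hr.le fun P hP => ?_)
  · rintro _ ⟨M, rfl⟩
    exact M.worstRevenue_le_of_excess_eq P₀ hc hcr
  · refine le_trans ?_ (hM P)
    rw [hcr]
    have := div_nonneg (sub_nonneg.2 hP) hL.le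
    linarith

/-! ### From a guarantee on the ball to a linear bound everywhere -/

/-- A mechanism that guarantees `c` on the ball of radius `excess P₀ c` degrades at the rate given
by the derivative of the excess. -/
lemma revenue_ge_of_hasDerivAt (M : Mechanism) (P₀ : Dist) {c L : ℝ} (hc : 0 < c) (hL : 0 < L)
    (hd : HasDerivAt (excess P₀) (-L) c)
    (hM : ∀ P, wdist P P₀ ≤ excess P₀ c → c ≤ revenue M P) (P : Dist) :
    c + (excess P₀ c - wdist P P₀) / L ≤ revenue M P := by
  have key : ∀ s, (wdist P P₀ - excess P₀ c) / L < s → c - s ≤ revenue M P := by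
    intro s hs
    rw [div_lt_iff₀ hL] at hs
    -- F t bounds the distance to `P₀` of the mixture giving weight t to P and 1 - t to the law
    -- capped at level c + st. Its derivative at 0 is d(P,P₀) - e(c) - Ls, negative by the choice of
    -- s, so the mixture lies in the ball for small t > 0.
    let F : ℝ → ℝ := fun t => (1 - t) * excess P₀ (c + s * t) + t * wdist P P₀
    have hF0 : F 0 = excess P₀ c := by simp [F]
    have hline : HasDerivAt (fun t : ℝ => c + s * t) s 0 := by
      simpa using ((hasDerivAt_id (0 : ℝ)).const_mul s).const_add c
    have hF : HasDerivAt F (-excess P₀ c + -L * s + wdist P P₀) 0 := by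
      have h1 : HasDerivAt (fun t => excess P₀ (c + s * t)) (-L * s) 0 :=
        HasDerivAt.comp_of_eq (0 : ℝ) hd hline (by simp)
      have h2 : HasDerivAt (fun t : ℝ => 1 - t) (-1) 0 := by
        simpa using (hasDerivAt_id (0 : ℝ)).const_sub 1
      have h3 := (h2.mul h1).add ((hasDerivAt_id (0 : ℝ)).mul_const (wdist P P₀))
      refine h3.congr_deriv ?_
      simp
    have hslope := hF.tendsto_slope_zero_right
    simp only [zero_add, smul_eq_mul] at hslope
    have hneg : ∀ᶠ t in 𝓝[>] (0 : ℝ), t⁻¹ * (F t - F 0) < 0 :=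
      hslope.eventually_lt_const (by linarith)
    -- The slope s may be negative, so positivity of the capping level holds only for small t.
    have hposc : ∀ᶠ t in 𝓝[>] (0 : ℝ), 0 < c + s * t :=
      nhdsWithin_le_nhds (hline.continuousAt.eventually_const_lt (by simpa using hc))
    have hlim : Tendsto (fun t : ℝ => c - (1 - t) * s) (𝓝[>] 0) (𝓝 (c - s)) := by
      have : Continuous fun t : ℝ => c - (1 - t) * s := by fun_prop
      simpa using (this.tendsto 0).mono_left nhdsWithin_le_nhds
    refine le_of_tendsto hlim ?_
    filter_upwards [hneg, hposc, Ioo_mem_nhdsGT (zero_lt_one' ℝ)] with t h1 h2 ht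
    obtain ⟨Q, hQ, hrev⟩ := exists_wdist_eq_excess P₀ h2
    obtain ⟨R, hR, hdR⟩ := exists_mixture Q P P₀ ht.1.le ht.2.le
    rw [hQ] at hdR
    have h3 : F t - F 0 < 0 := (pos_iff_neg_of_mul_neg h1).1 (inv_pos.2 ht.1)
    have h4 := hM R (by simp only [F] at h3; simp only [F] at hF0; linarith)
    rw [hR] at h4
    have h5 := mul_le_mul_of_nonneg_left (hrev M) (sub_nonneg.2 ht.2.le)
    -- The mixture earns at least c while its capped part earns at most c + st; the remainder must
    -- come from P. Dividing by t and letting t tend to 0 gives the bound c - s.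
    have h6 : t * (c - (1 - t) * s) ≤ t * revenue M P := by linarith
    exact le_of_mul_le_mul_left h6 ht.1
  have h := le_of_forall_gt_imp_ge_of_dense fun s hs => sub_le_comm.1 (key s hs)
  have h' : (excess P₀ c - wdist P P₀) / L = -((wdist P P₀ - excess P₀ c) / L) := by ring
  linarith

/-! ### Interval selectors and closed forms -/

lemma integral_indicator_Ico {f : ℝ → ℝ} {u w v : ℝ} (hu : 0 ≤ u) (huw : u < w) (hv : 0 ≤ v) :
    ∫ x in (0 : ℝ)..v, (Ico u w).indicator f x = ∫ x in u..min (max v u) w, f x := by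
  have hle : u ≤ min (max v u) w := le_min (le_max_right _ _) huw.le
  rw [intervalIntegral.integral_of_le hv, intervalIntegral.integral_of_le hle,
    setIntegral_indicator measurableSet_Ico]
  refine setIntegral_congr_set (((ae_eq_refl _).inter Ico_ae_eq_Ioc).trans (Eq.eventuallyEq ?_))
  rw [Ioc_inter_Ioc, max_eq_right hu]
  rcases le_total v u with h | h
  · rw [max_eq_right h, min_eq_left huw.le, Ioc_eq_empty_of_le ((min_le_left _ _).trans h),
      Ioc_self]
  · rw [max_eq_left h]

/-- The selector of a finite family of intervals. -/
noncomputable def intervalSelector {J : ℕ} (u w : Fin J → ℝ) (x : ℝ) : ℝ :=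
  ∑ j, (Ico (u j) (w j)).indicator 1 x

lemma measurable_intervalSelector {J : ℕ} (u w : Fin J → ℝ) : Measurable (intervalSelector u w) :=
  Finset.measurable_sum _ fun _ _ => measurable_one.indicator measurableSet_Ico

/-- A primitive of a function restricted to finitely many intervals. -/
lemma integral_intervalSelector_mul {J : ℕ} {u w : Fin J → ℝ} (hu : ∀ j, 0 < u j)
    (huw : ∀ j, u j < w j) {f : ℝ → ℝ} (hf : ContinuousOn f (Ioi 0)) {v : ℝ} (hv : 0 ≤ v) :
    ∫ x in (0 : ℝ)..v, intervalSelector u w x * f x =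
      ∑ j, ∫ x in u j..min (max v (u j)) (w j), f x := by
  have h1 : ∀ x, intervalSelector u w x * f x = ∑ j, (Ico (u j) (w j)).indicator f x := by
    intro x
    rw [intervalSelector, Finset.sum_mul]
    refine Finset.sum_congr rfl fun j _ => ?_
    by_cases h : x ∈ Ico (u j) (w j) <;> simp [h]
  simp_rw [h1]
  rw [intervalIntegral.integral_finsetSum]
  · exact Finset.sum_congr rfl fun j _ => integral_indicator_Ico (hu j).le (huw j) hv
  · intro j _
    have hI : IntegrableOn f (Icc (u j) (w j)) :=
      (hf.mono fun x hx => (hu j).trans_le hx.1).integrableOn_Icc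
    exact ((integrable_indicator_iff measurableSet_Ico).2
      (hI.mono_set Ico_subset_Icc_self)).intervalIntegrable

lemma integral_intervalSelector_div {J : ℕ} {u w : Fin J → ℝ} (hu : ∀ j, 0 < u j)
    (huw : ∀ j, u j < w j) {v : ℝ} (hv : 0 ≤ v) :
    ∫ x in (0 : ℝ)..v, intervalSelector u w x / x =
      ∑ j, Real.log (min (max v (u j)) (w j) / u j) := by
  simp_rw [div_eq_mul_inv (intervalSelector u w _)]
  rw [integral_intervalSelector_mul hu huw
    (continuousOn_inv₀.mono fun x (hx : 0 < x) => hx.ne') hv]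
  refine Finset.sum_congr rfl fun j _ => ?_
  exact integral_inv_of_pos (hu j)
    (lt_min (lt_max_of_lt_right (hu j)) ((hu j).trans (huw j)))

lemma integral_intervalSelector {J : ℕ} {u w : Fin J → ℝ} (hu : ∀ j, 0 < u j)
    (huw : ∀ j, u j < w j) {v : ℝ} (hv : 0 ≤ v) :
    ∫ x in (0 : ℝ)..v, intervalSelector u w x = ∑ j, (min (max v (u j)) (w j) - u j) := by
  have := integral_intervalSelector_mul hu huw (f := fun _ => 1) continuousOn_const hv
  simpa using this

namespace IsExceedance

variable {P₀ : Dist} {c : ℝ} {J : ℕ} {u w : Fin J → ℝ} (h : IsExceedance P₀ c u w)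
include h

/-- At x = 0 the posted-price revenue is 0 < c, so no interval can start there; the logarithms of
w/u are therefore genuine. -/
lemma left_pos (hc : 0 < c) (j : Fin J) : 0 < u j := by
  refine (h.nonneg j).lt_of_ne fun h0 => ?_
  have := h.ge j (u j) ⟨le_rfl, h.lt j⟩
  rw [← h0, zero_mul] at this
  linarith

lemma selector_eq_one {x : ℝ} {j : Fin J} (hx : x ∈ Ico (u j) (w j)) :
    intervalSelector u w x = 1 := by
  rw [intervalSelector, Finset.sum_eq_single j _ (fun hj => absurd (Finset.mem_univ j) hj)]
  · simp [hx]
  · intro i _ hij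
    refine indicator_of_notMem (fun hi => ?_) _
    rcases hij.lt_or_gt with hlt | hlt
    · linarith [h.sep i j hlt, hx.1, hi.2]
    · linarith [h.sep j i hlt, hx.2, hi.1]

omit h in
lemma selector_eq_zero {x : ℝ} (hx : ∀ j, x ∉ Ico (u j) (w j)) : intervalSelector u w x = 0 :=
  Finset.sum_eq_zero fun j _ => indicator_of_notMem (hx j) _

lemma selector_mem (x : ℝ) : intervalSelector u w x ∈ Icc (0 : ℝ) 1 := by
  by_cases hx : ∃ j, x ∈ Ico (u j) (w j)
  · obtain ⟨j, hj⟩ := hx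
    simp [h.selector_eq_one hj]
  · simp [selector_eq_zero (not_exists.1 hx)]

lemma selector_eq_one_of_gt {x : ℝ} (hx : x ∈ Ioc (0 : ℝ) 1) (hgt : c < x * ccdf P₀ x) :
    intervalSelector u w x = 1 := by
  obtain ⟨j, hj⟩ := h.exceed x ⟨hx.1.le, hx.2⟩ hgt
  exact h.selector_eq_one hj

lemma selector_eq_zero_of_lt {x : ℝ} (hlt : x * ccdf P₀ x < c) : intervalSelector u w x = 0 :=
  selector_eq_zero fun j hj => (h.ge j x hj).not_gt hlt

/-- Ties may fall inside or outside the intervals: there the difference is 0 and the value of the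
selector is irrelevant. -/
lemma max_eq_selector_mul {x : ℝ} (hx : x ∈ Ioc (0 : ℝ) 1) :
    max (ccdf P₀ x - c / x) 0 = intervalSelector u w x * (ccdf P₀ x - c / x) := by
  rcases lt_trichotomy (x * ccdf P₀ x) c with hlt | heq | hgt
  · rw [h.selector_eq_zero_of_lt hlt, zero_mul]
    refine max_eq_right (sub_nonpos.2 ((le_div_iff₀ hx.1).2 ?_))
    linarith
  · have : ccdf P₀ x - c / x = 0 := by
      rw [sub_eq_zero, eq_div_iff hx.1.ne', mul_comm, heq]
    rw [this, max_self, mul_zero]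
  · rw [h.selector_eq_one_of_gt hx hgt, one_mul]
    refine max_eq_left (sub_nonneg.2 ((div_le_iff₀ hx.1).2 ?_))
    linarith

end IsExceedance

/-! ### Fragility in the robust satisficing problem -/

/-- With target `c + r / L`, no fragility below `1 / L` is feasible. -/
lemma RSFeasible.inv_le {P₀ : Dist} {r c L k : ℝ} {M : Mechanism} (hr : 0 < r) (hc : 0 < c)
    (hcr : excess P₀ c = r) (h : RSFeasible P₀ (c + r / L) M k) : 1 / L ≤ k := by
  obtain ⟨P, hP, hrev⟩ := exists_wdist_eq_excess P₀ hc
  have h1 := h.2 P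
  have h2 := hrev M
  rw [hP, hcr] at h1
  refine le_of_mul_le_mul_right ?_ hr
  rw [one_div_mul_eq_div]
  linarith

lemma rsFeasible_of_revenue_ge {P₀ : Dist} {r c L : ℝ} {M : Mechanism} (hL : 0 < L)
    (h : ∀ P, c + (r - wdist P P₀) / L ≤ revenue M P) :
    RSFeasible P₀ (c + r / L) M (1 / L) := by
  refine ⟨by positivity, fun P => ?_⟩
  have := h P
  rw [sub_div] at this
  rw [one_div_mul_eq_div]
  linarith

end RobustMechanism

open RobustMechanism
theorem theorem4 (P₀ : Dist) (r τ : ℝ) (hr : 0 < r) (hrμ : r < mean P₀)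
    (J : ℕ) (u w : Fin J → ℝ) (huw : IsExceedance P₀ (roValue P₀ r) u w)
    (hτ : τ = roValue P₀ r + r / ∑ j, Real.log (w j / u j)) :
    (∃ M : Mechanism,
      (∀ v : Val, M.q v = (∑ j, Real.log (min (max (v : ℝ) (u j)) (w j) / u j)) /
        ∑ j, Real.log (w j / u j)) ∧
      (∀ v : Val, M.m v = (∑ j, (min (max (v : ℝ) (u j)) (w j) - u j)) /
        ∑ j, Real.log (w j / u j)) ∧
      M ∈ roOptimal P₀ r ∧ M ∈ rsOptimal P₀ τ) ∧
    rsOptimal P₀ τ ⊆ roOptimal P₀ r ∧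
    (volume {x : ℝ | x ∈ Set.Icc (0 : ℝ) 1 ∧ x * ccdf P₀ x = roValue P₀ r} = 0 →
      roOptimal P₀ r = rsOptimal P₀ τ) := by
  obtain ⟨c, hc, hcr⟩ := exists_excess_eq P₀ hr hrμ
  rw [roValue_eq P₀ hr hc hcr] at huw hτ ⊢
  have hu := huw.left_pos hc
  have hlog : ∫ x in (0 : ℝ)..1, intervalSelector u w x / x = ∑ j, Real.log (w j / u j) := by
    rw [integral_intervalSelector_div hu huw.lt zero_le_one]
    refine Finset.sum_congr rfl fun j _ => ?_
    rw [max_eq_left ((huw.lt j).le.trans (huw.le_one j)), min_eq_right (huw.le_one j)]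
  obtain ⟨hL, M, hq, hm, hM⟩ := exists_mechanism_revenue_ge P₀ hc (measurable_intervalSelector u w)
    (fun x => (huw.selector_mem x).1) (fun x => (huw.selector_mem x).2)
    (fun x hx => huw.max_eq_selector_mul hx) (hcr ▸ hr)
  simp only [hlog] at hL hq hm hM
  simp only [hcr] at hM
  set L := ∑ j, Real.log (w j / u j)
  subst hτ
  have ro_of_rev : ∀ M' : Mechanism, (∀ P, c + (r - wdist P P₀) / L ≤ revenue M' P) →
      M' ∈ roOptimal P₀ r := fun M' hM' M'' =>
    (M''.worstRevenue_le_of_excess_eq P₀ hc hcr).trans <| M'.le_worstRevenue hr.le fun P hP => by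
      have := hM' P
      have := div_nonneg (sub_nonneg.2 hP) hL.le
      linarith
  have rs_of_rev : ∀ M' : Mechanism, (∀ P, c + (r - wdist P P₀) / L ≤ revenue M' P) →
      M' ∈ rsOptimal P₀ (c + r / L) := fun M' hM' =>
    ⟨1 / L, rsFeasible_of_revenue_ge hL hM', fun _ _ h => h.inv_le hr hc hcr⟩
  -- The explicit mechanism is feasible with fragility 1/L, so the least fragility is at most 1/L,
  -- and RS feasibility then reads as the linear bound.
  have rev_of_rs : ∀ M' ∈ rsOptimal P₀ (c + r / L),
      ∀ P, c + (r - wdist P P₀) / L ≤ revenue M' P := by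
    rintro M' ⟨k, hk, hmin⟩ P
    have h1 : k ≤ 1 / L := hmin M _ (rsFeasible_of_revenue_ge hL hM)
    have h2 := mul_le_mul_of_nonneg_right h1 (wdist_nonneg P P₀)
    rw [one_div_mul_eq_div] at h2
    have h3 := hk.2 P
    rw [sub_div]
    linarith
  have rs_subset : rsOptimal P₀ (c + r / L) ⊆ roOptimal P₀ r := fun M' h =>
    ro_of_rev M' (rev_of_rs M' h)
  refine ⟨⟨M, fun v => ?_, fun v => ?_, ro_of_rev M hM, rs_of_rev M hM⟩, rs_subset,
    fun hnull => Subset.antisymm (fun M' hM' => rs_of_rev M' ?_) rs_subset⟩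
  · rw [hq, integral_intervalSelector_div hu huw.lt v.2.1]
  · rw [hm, integral_intervalSelector hu huw.lt v.2.1]
  · have hd := hasDerivAt_excess P₀ hc (measurable_intervalSelector u w)
      (fun x hx => huw.selector_eq_one_of_gt hx) (fun x _ => huw.selector_eq_zero_of_lt) hnull
    rw [hlog] at hd
    have hworst : c ≤ worstRevenue P₀ r M :=
      M.le_worstRevenue hr.le fun P hP => by
        have := hM P
        have := div_nonneg (sub_nonneg.2 hP) hL.le
        linarith
    have := revenue_ge_of_hasDerivAt M' P₀ hc hL hd fun P hP =>
      (hworst.trans (hM' M)).trans (M'.worstRevenue_le (hP.trans hcr.le))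
    rwa [hcr] at this
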